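/- Let $A$ be a commutative noetherian ring and let $M$ be a finitely generated $A$-module. Write $N^\ast=\operatorname{Hom}_A(N,A)$ for the dual of an $A$-module $N$. Let $$\mathcal{R}(M)=\operatorname{Sym}(M)\Big/\bigcap_{g}\ker\bigl(\operatorname{Sym}(g)\colon\operatorname{Sym}(M)\to\operatorname{Sym}(E)\bigr)$$ be the Rees algebra of $M$ in the sense of Eisenbud, Huneke and Ulrich, where $g$ runs over all homomorphisms $g\colon M\to E$ from $M$ to free $A$-modules $E$, with the grading induced from $\operatorname{Sym}(M)$. Let $\Gamma(M^\ast)=\bigoplus_{n\ge0}\Gamma^n(M^\ast)$ be the graded divided power algebra of $M^\ast$, generated by symbols $\gamma^n(x)$ ($n\ge 0$, $x\in M^\ast$), with its comultiplication $\Delta$ given by $\gamma^n(x)\mapsto\sum_{i+j=n}\gamma^i(x)\otimes\gamma^j(x)$, and let $$\Gamma(M^\ast)^\vee=\bigoplus_{n\ge0}\operatorname{Hom}_A\bigl(\Gamma^n(M^\ast),A\bigr)$$ be its graded dual, a commutative graded $A$-algebra under the product of $u\in\Gamma^i(M^\ast)^\ast$ and $v\in\Gamma^j(M^\ast)^\ast$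 given by $(u\bullet v)(\gamma)=(u\otimes v)(\Delta(\gamma))$ for $\gamma\in\Gamma^{i+j}(M^\ast)$. Let $$c_M\colon\operatorname{Sym}(M)\to\Gamma(M^\ast)^\vee$$ be the homomorphism of $A$-algebras induced by the canonical homomorphism $M\to M^{\ast\ast}$, where $M^{\ast\ast}=\operatorname{Hom}_A(\Gamma^1(M^\ast),A)$ is the degree $1$ part of $\Gamma(M^\ast)^\vee$. Then $$\mathcal{R}(M)=\operatorname{im}\bigl(c_M\colon\operatorname{Sym}(M)\to\Gamma(M^\ast)^\vee\bigr)$$ as graded $A$-algebras; that is, there is an isomorphism of $A$-algebras $\mathcal{R}(M)\to\operatorname{im}(c_M)$ sending the class of $x$ to $c_M(x)$ for every $x\in\operatorname{Sym}(M)$, and an element of $\mathcal{R}(M)$ is homogeneous of degree $n$ if and only if its image in $\Gamma(M^\ast)^\vee$ is (zero being homogeneous of every degree). -/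

import Mathlib

universe u v w

noncomputable section

open scoped TensorProduct DirectSum

namespace DividedPowerAlgebra

variable (A : Type*) [CommRing A] (N : Type*) [AddCommGroup N] [Module A N]

/-- The degree `n` part `Γⁿ(N)` of the divided power algebra: the span of all products
`γ^{n₁}(x₁) × ⋯ × γ^{n_k}(x_k)` with `n₁ + ⋯ + n_k = n`. -/
def grade (n : ℕ) : Submodule A (DividedPowerAlgebra A N) :=
  Submodule.span A {z | ∃ l : List (ℕ × N), (l.map Prod.fst).sum = n ∧
    z = (l.map fun p => dp A p.1 p.2).prod}

variable {A N}

lemma algHom_ext_of_dp {B : Type*} [Semiring B] [Algebra A B] {f g : DividedPowerAlgebra A N →ₐ[A] B}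
    (h : ∀ n x, f (dp A n x) = g (dp A n x)) : f = g := by
  refine AlgHom.ext fun z => ?_
  induction z using DividedPowerAlgebra.induction_on with
  | C a => rw [AlgHom.commutes, AlgHom.commutes]
  | add z w hz hw => rw [map_add, map_add, hz, hw]
  | dp z n x hz => rw [map_mul, map_mul, hz, h]

lemma dp_mem_grade (n : ℕ) (x : N) : dp A n x ∈ grade A N n :=
  Submodule.subset_span ⟨[(n, x)], by simp, by simp⟩

instance grade_gradedMonoid : SetLike.GradedMonoid (grade A N) where
  one_mem := Submodule.subset_span ⟨[], by simp, by simp⟩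
  mul_mem := by
    intro i j a b ha hb
    have h : grade A N i * grade A N j ≤ grade A N (i + j) := by
      rw [grade, grade, Submodule.span_mul_span, Submodule.span_le]
      rintro _ ⟨_, ⟨l, hl, rfl⟩, _, ⟨l', hl', rfl⟩, rfl⟩
      exact Submodule.subset_span ⟨l ++ l', by simp [hl, hl'], by simp⟩
    exact h (Submodule.mul_mem_mul ha hb)

lemma of_dp_mul (n p : ℕ) (x : N) :
    DirectSum.of (fun i => grade A N i) n ⟨dp A n x, dp_mem_grade n x⟩ *
      DirectSum.of (fun i => grade A N i) p ⟨dp A p x, dp_mem_grade p x⟩ =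
    (n + p).choose n • DirectSum.of (fun i => grade A N i) (n + p)
      ⟨dp A (n + p) x, dp_mem_grade (n + p) x⟩ := by
  rw [DirectSum.of_mul_of, ← map_nsmul]
  congr 1
  exact Subtype.ext dp_mul

/-- The algebra map `Γ(N) → ⨁ₙ Γⁿ(N)` sending `γⁿ(x)` to itself placed in degree `n`. -/
def decomposeHom : DividedPowerAlgebra A N →ₐ[A] ⨁ n, grade A N n :=
  lift' (f := fun p : ℕ × N =>
      DirectSum.of (fun i => grade A N i) p.1 ⟨dp A p.1 p.2, dp_mem_grade p.1 p.2⟩)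
    (fun x => by
      rw [DirectSum.one_def]
      congr 1
      exact Subtype.ext dp_zero)
    (fun n r x => by
      rw [← DirectSum.lof_eq_of A, ← DirectSum.lof_eq_of A, ← map_smul]
      congr 1
      exact Subtype.ext dp_smul)
    of_dp_mul
    (fun n x y => by
      have h : (⟨dp A n (x + y), dp_mem_grade n (x + y)⟩ : grade A N n) =
          ∑ k : Finset.HasAntidiagonal.antidiagonal n, ⟨dp A k.1.1 x * dp A k.1.2 y, by
            have := SetLike.mul_mem_graded (dp_mem_grade (A := A) k.1.1 x) (dp_mem_grade k.1.2 y)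
            rwa [Finset.HasAntidiagonal.mem_antidiagonal.1 k.2] at this⟩ := by
        apply Subtype.ext
        rw [AddSubmonoidClass.coe_finsetSum]
        exact dp_add.trans (Finset.sum_coe_sort (Finset.HasAntidiagonal.antidiagonal n)
          fun k => dp A k.1 x * dp A k.2 y).symm
      simp only [h, map_sum]
      rw [← Finset.sum_coe_sort (Finset.HasAntidiagonal.antidiagonal n)]
      refine Finset.sum_congr rfl fun k _ => ?_
      rw [DirectSum.of_mul_of]
      refine DirectSum.of_eq_of_gradedMonoid_eq (Sigma.subtype_ext ?_ rfl)
      exact (Finset.HasAntidiagonal.mem_antidiagonal.1 k.2).symm)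

@[simp] lemma decomposeHom_dp (n : ℕ) (x : N) : decomposeHom (dp A n x) =
    DirectSum.of (fun i => grade A N i) n ⟨dp A n x, dp_mem_grade n x⟩ :=
  lift'_apply_dp ..

/-- `Γ(N) = ⨁ₙ Γⁿ(N)` is a graded algebra. -/
instance grade_gradedAlgebra : GradedAlgebra (grade A N) :=
  GradedAlgebra.ofAlgHom _ decomposeHom
    (algHom_ext fun n m => by simp)
    (by
      have key : ∀ l : List (ℕ × N), ∀ h,
          decomposeHom ((l.map fun p => dp A p.1 p.2).prod) =
            DirectSum.of (fun i => grade A N i) (l.map Prod.fst).sum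
              ⟨(l.map fun p => dp A p.1 p.2).prod, h⟩ := by
        intro l
        induction l with
        | nil => intro h; simp only [List.map_nil, List.prod_nil, map_one]; rfl
        | cons p l ih =>
          intro h
          simp only [List.map_cons, List.prod_cons, map_mul, decomposeHom_dp]
          rw [ih (Submodule.subset_span ⟨l, rfl, rfl⟩), DirectSum.of_mul_of]
          rfl
      rintro i ⟨x, hx⟩
      change decomposeHom x = _
      induction hx using Submodule.span_induction with
      | mem x h => obtain ⟨l, rfl, rfl⟩ := h; exact key l _
      | zero => rw [map_zero]; exact (map_zero _).symm
      | add x y hx hy h1 h2 => rw [map_add, h1, h2, ← map_add]; rfl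
      | smul a x hx h =>
        rw [map_smul, h, ← DirectSum.lof_eq_of A, ← map_smul]; rfl)

lemma sum_tmul_mul_sum_tmul (n p : ℕ) (x : N) :
    (∑ k ∈ Finset.HasAntidiagonal.antidiagonal n, dp A k.1 x ⊗ₜ[A] dp A k.2 x) *
      (∑ k ∈ Finset.HasAntidiagonal.antidiagonal p, dp A k.1 x ⊗ₜ[A] dp A k.2 x) =
    (n + p).choose n • ∑ k ∈ Finset.HasAntidiagonal.antidiagonal (n + p), dp A k.1 x ⊗ₜ[A] dp A k.2 x := by
  rw [Finset.sum_mul_sum, Finset.smul_sum]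
  have h1 : ∀ i ∈ Finset.HasAntidiagonal.antidiagonal n,
      (∑ j ∈ Finset.HasAntidiagonal.antidiagonal p, dp A i.1 x ⊗ₜ[A] dp A i.2 x * dp A j.1 x ⊗ₜ[A] dp A j.2 x) =
      ∑ k ∈ Finset.HasAntidiagonal.antidiagonal (n + p),
        (k.1.choose i.1 * k.2.choose i.2) • (dp A k.1 x ⊗ₜ[A] dp A k.2 x) := by
    intro i hi
    have hi' := Finset.HasAntidiagonal.mem_antidiagonal.1 hi
    refine Finset.sum_of_injOn (fun j => (i.1 + j.1, i.2 + j.2)) ?_ ?_ ?_ ?_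
    · rintro ⟨a, b⟩ - ⟨c, d⟩ - h
      simpa using h
    · rintro ⟨a, b⟩ h
      simp only [Finset.mem_coe,
        Finset.HasAntidiagonal.mem_antidiagonal] at h ⊢
      omega
    · rintro ⟨a, b⟩ h hn
      simp only [Finset.HasAntidiagonal.mem_antidiagonal] at h
      by_cases ha : a < i.1
      · simp [Nat.choose_eq_zero_of_lt ha]
      by_cases hb : b < i.2
      · simp [Nat.choose_eq_zero_of_lt hb]
      refine absurd ⟨(a - i.1, b - i.2), ?_, ?_⟩ hn
      · simp only [Finset.mem_coe, Finset.HasAntidiagonal.mem_antidiagonal]; omega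
      · simp only [Prod.mk.injEq]; omega
    · rintro ⟨a, b⟩ -
      rw [Algebra.TensorProduct.tmul_mul_tmul, dp_mul, dp_mul, TensorProduct.tmul_smul,
        ← TensorProduct.smul_tmul', smul_smul, mul_comm]
  rw [Finset.sum_congr rfl h1, Finset.sum_comm]
  refine Finset.sum_congr rfl fun k hk => ?_
  rw [← Finset.sum_smul, ← Finset.HasAntidiagonal.mem_antidiagonal.1 hk, Nat.add_choose_eq]

/-- The comultiplication of `Γ(N)`, induced by the diagonal `N → N ⊕ N`: the algebra map with
`γⁿ(x) ↦ ∑_{i+j=n} γⁱ(x) ⊗ γʲ(x)`. -/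
def comulHom : DividedPowerAlgebra A N →ₐ[A] DividedPowerAlgebra A N ⊗[A] DividedPowerAlgebra A N :=
  lift' (f := fun p : ℕ × N => ∑ k ∈ Finset.HasAntidiagonal.antidiagonal p.1, dp A k.1 p.2 ⊗ₜ[A] dp A k.2 p.2)
    (fun x => by simp [dp_zero, Algebra.TensorProduct.one_def])
    (fun n r x => by
      rw [Finset.smul_sum]
      refine Finset.sum_congr rfl fun k hk => ?_
      rw [dp_smul, dp_smul, TensorProduct.tmul_smul, ← TensorProduct.smul_tmul', smul_smul,
        ← pow_add, add_comm, Finset.HasAntidiagonal.mem_antidiagonal.1 hk])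
    sum_tmul_mul_sum_tmul
    (fun n x y => by
      let E : N → PowerSeries (DividedPowerAlgebra A N) := fun z => PowerSeries.mk fun n => dp A n z
      have hE : E (x + y) = E x * E y := by
        ext m; simp [E, PowerSeries.coeff_mul, dp_add]
      let E₁ : N → PowerSeries (DividedPowerAlgebra A N ⊗[A] DividedPowerAlgebra A N) := fun z =>
        (E z).map (Algebra.TensorProduct.includeLeft (R := A) (S := A)).toRingHom
      let E₂ : N → PowerSeries (DividedPowerAlgebra A N ⊗[A] DividedPowerAlgebra A N) := fun z =>
        (E z).map (Algebra.TensorProduct.includeRight (R := A)).toRingHom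
      have hc : ∀ m z, (E₁ z * E₂ z).coeff m =
          ∑ k ∈ Finset.HasAntidiagonal.antidiagonal m, dp A k.1 z ⊗ₜ[A] dp A k.2 z := by
        intro m z; simp [E₁, E₂, E, PowerSeries.coeff_mul]
      simp only [← hc]
      rw [← PowerSeries.coeff_mul]
      congr 1
      simp only [E₁, E₂, hE, map_mul]
      ring)

@[simp] lemma comulHom_dp (n : ℕ) (x : N) : comulHom (dp A n x) =
    ∑ k ∈ Finset.HasAntidiagonal.antidiagonal n, dp A k.1 x ⊗ₜ[A] dp A k.2 x :=
  lift'_apply_dp ..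

/-- The counit of `Γ(N)`, induced by `N → 0`: it is the identity on constants, and kills `γⁿ(x)`
for `n > 0`. -/
def counitHom : DividedPowerAlgebra A N →ₐ[A] A :=
  lift' (f := fun p : ℕ × N => if p.1 = 0 then 1 else 0)
    (fun x => by simp)
    (fun n r x => by by_cases h : n = 0 <;> simp [h])
    (fun n p x => by by_cases h : n = 0 <;> by_cases h' : p = 0 <;> simp [h, h'])
    (fun n x y => by
      cases n with
      | zero => simp
      | succ n =>
        rw [Finset.sum_eq_zero]; · simp
        rintro ⟨a, b⟩ h
        have := Finset.HasAntidiagonal.mem_antidiagonal.1 h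
        by_cases ha : a = 0 <;> by_cases hb : b = 0 <;> simp_all)

@[simp] lemma counitHom_dp (n : ℕ) (x : N) :
    counitHom (dp A n x) = if n = 0 then (1 : A) else 0 :=
  lift'_apply_dp ..

lemma comulHom_coassoc :
    (Algebra.TensorProduct.assoc A A A (DividedPowerAlgebra A N) (DividedPowerAlgebra A N)
      (DividedPowerAlgebra A N)).toAlgHom.comp
      ((Algebra.TensorProduct.map comulHom (.id A (DividedPowerAlgebra A N))).comp comulHom)
      = (Algebra.TensorProduct.map (.id A (DividedPowerAlgebra A N)) comulHom).comp
        (comulHom (A := A) (N := N)) := by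
  apply algHom_ext_of_dp
  intro n x
  simp only [AlgHom.comp_apply, comulHom_dp, map_sum, Algebra.TensorProduct.map_tmul,
    AlgHom.id_apply, TensorProduct.tmul_sum, TensorProduct.sum_tmul]
  rw [Finset.sum_sigma', Finset.sum_sigma']
  refine Finset.sum_nbij' (fun s => ⟨(s.2.1, s.2.2 + s.1.2), (s.2.2, s.1.2)⟩)
    (fun s => ⟨(s.1.1 + s.2.1, s.2.2), (s.1.1, s.2.1)⟩) ?_ ?_ ?_ ?_ ?_
  · rintro ⟨⟨a, b⟩, ⟨c, d⟩⟩ h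
    simp only [Finset.mem_sigma, Finset.HasAntidiagonal.mem_antidiagonal] at h ⊢
    obtain ⟨rfl, rfl⟩ := h
    simp [add_assoc]
  · rintro ⟨⟨a, b⟩, ⟨c, d⟩⟩ h
    simp only [Finset.mem_sigma, Finset.HasAntidiagonal.mem_antidiagonal] at h ⊢
    obtain ⟨rfl, rfl⟩ := h
    simp [add_assoc]
  · rintro ⟨⟨a, b⟩, ⟨c, d⟩⟩ h
    simp only [Finset.mem_sigma, Finset.HasAntidiagonal.mem_antidiagonal] at h
    obtain ⟨-, rfl⟩ := h
    rfl
  · rintro ⟨⟨a, b⟩, ⟨c, d⟩⟩ h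
    simp only [Finset.mem_sigma, Finset.HasAntidiagonal.mem_antidiagonal] at h
    obtain ⟨-, rfl⟩ := h
    rfl
  · rintro ⟨⟨a, b⟩, ⟨c, d⟩⟩ -
    rfl

lemma counitHom_comul_left :
    (Algebra.TensorProduct.map counitHom (.id A (DividedPowerAlgebra A N))).comp
      (comulHom (A := A) (N := N)) =
      ((Algebra.TensorProduct.lid A (DividedPowerAlgebra A N)).symm :
        DividedPowerAlgebra A N →ₐ[A] A ⊗[A] DividedPowerAlgebra A N) := by
  apply algHom_ext_of_dp
  intro n x
  simp only [AlgHom.comp_apply, comulHom_dp, map_sum, Algebra.TensorProduct.map_tmul,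
    counitHom_dp, AlgHom.id_apply]
  rw [Finset.sum_eq_single (0, n)]
  · simp
  · rintro ⟨a, b⟩ h hn
    have := Finset.HasAntidiagonal.mem_antidiagonal.1 h
    have ha : a ≠ 0 := by rintro rfl; simp_all
    simp [ha]
  · simp

lemma counitHom_comul_right :
    (Algebra.TensorProduct.map (.id A (DividedPowerAlgebra A N)) counitHom).comp
      (comulHom (A := A) (N := N)) =
      ((Algebra.TensorProduct.rid A A (DividedPowerAlgebra A N)).symm :
        DividedPowerAlgebra A N →ₐ[A] DividedPowerAlgebra A N ⊗[A] A) := by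
  apply algHom_ext_of_dp
  intro n x
  simp only [AlgHom.comp_apply, comulHom_dp, map_sum, Algebra.TensorProduct.map_tmul,
    counitHom_dp, AlgHom.id_apply]
  rw [Finset.sum_eq_single (n, 0)]
  · simp
  · rintro ⟨a, b⟩ h hn
    have := Finset.HasAntidiagonal.mem_antidiagonal.1 h
    have hb : b ≠ 0 := by rintro rfl; simp_all
    simp [hb]
  · simp

/-- The bialgebra structure of `Γ(N)`. -/
instance bialgebra : Bialgebra A (DividedPowerAlgebra A N) :=
  Bialgebra.ofAlgHom comulHom counitHom comulHom_coassoc counitHom_comul_left counitHom_comul_right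

instance isCocomm : Coalgebra.IsCocomm A (DividedPowerAlgebra A N) where
  comm_comp_comul := by
    have : (Algebra.TensorProduct.comm A (DividedPowerAlgebra A N)
        (DividedPowerAlgebra A N)).toAlgHom.comp comulHom = comulHom := by
      apply algHom_ext_of_dp
      intro n x
      simp only [AlgHom.comp_apply, comulHom_dp, map_sum]
      rw [← Finset.Nat.sum_antidiagonal_swap]
      refine Finset.sum_congr rfl fun k _ => ?_
      simp
    exact congr(($this).toLinearMap)

lemma comul_apply (z : DividedPowerAlgebra A N) :
    Coalgebra.comul (R := A) z = comulHom z := rfl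

lemma counit_apply (z : DividedPowerAlgebra A N) :
    Coalgebra.counit (R := A) z = counitHom z := rfl


/-- The projection `Γ(N) → Γⁿ(N)`. -/
def gradeProj (n : ℕ) : DividedPowerAlgebra A N →ₗ[A] grade A N n :=
  DirectSum.component A ℕ (fun i => grade A N i) n ∘ₗ
    (DirectSum.decomposeLinearEquiv (grade A N)).toLinearMap

lemma gradeProj_same (n : ℕ) (z : grade A N n) : gradeProj n (z : DividedPowerAlgebra A N) = z := by
  simp [gradeProj, DirectSum.component.lof_self]

lemma gradeProj_ne {m n : ℕ} (h : m ≠ n) {z : DividedPowerAlgebra A N} (hz : z ∈ grade A N m) :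
    gradeProj n z = 0 :=
  Subtype.ext (DirectSum.decompose_of_mem_ne (grade A N) hz h)

/-- The span of the `a ⊗ b` with `a ∈ Γⁱ(N)`, `b ∈ Γʲ(N)`, `i + j = n`. -/
def tensorGrade (A : Type*) [CommRing A] (N : Type*) [AddCommGroup N] [Module A N] (n : ℕ) :
    Submodule A (DividedPowerAlgebra A N ⊗[A] DividedPowerAlgebra A N) :=
  Submodule.span A {t | ∃ i j, i + j = n ∧ ∃ a ∈ grade A N i, ∃ b ∈ grade A N j, t = a ⊗ₜ[A] b}

lemma comul_mem_tensorGrade {n : ℕ} {z : DividedPowerAlgebra A N} (hz : z ∈ grade A N n) :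
    Coalgebra.comul (R := A) z ∈ tensorGrade A N n := by
  have hmul : ∀ i j, tensorGrade A N i * tensorGrade A N j ≤ tensorGrade A N (i + j) := by
    intro i j
    rw [tensorGrade, tensorGrade, Submodule.span_mul_span, Submodule.span_le]
    rintro _ ⟨_, ⟨i₁, i₂, hi, a, ha, b, hb, rfl⟩, _, ⟨j₁, j₂, hj, c, hc, d, hd, rfl⟩, rfl⟩
    exact Submodule.subset_span ⟨i₁ + j₁, i₂ + j₂, by omega, a * c, SetLike.mul_mem_graded ha hc,
      b * d, SetLike.mul_mem_graded hb hd, Algebra.TensorProduct.tmul_mul_tmul ..⟩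
  rw [comul_apply]
  induction hz using Submodule.span_induction with
  | mem z h =>
    obtain ⟨l, rfl, rfl⟩ := h
    induction l with
    | nil =>
      simp only [List.map_nil, List.prod_nil, map_one, List.sum_nil]
      exact Submodule.subset_span ⟨0, 0, rfl, 1, SetLike.GradedOne.one_mem, 1,
        SetLike.GradedOne.one_mem, Algebra.TensorProduct.one_def⟩
    | cons p l ih =>
      simp only [List.map_cons, List.prod_cons, map_mul, comulHom_dp, List.sum_cons]
      refine hmul _ _ (Submodule.mul_mem_mul (Submodule.sum_mem _ fun k hk => ?_) ih)
      exact Submodule.subset_span ⟨k.1, k.2, Finset.HasAntidiagonal.mem_antidiagonal.1 hk,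
        _, dp_mem_grade _ _, _, dp_mem_grade _ _, rfl⟩
  | zero => rw [map_zero]; exact Submodule.zero_mem _
  | add x y _ _ h1 h2 => rw [map_add]; exact Submodule.add_mem _ h1 h2
  | smul a x _ h => rw [map_smul]; exact Submodule.smul_mem _ _ h

/-- The graded dual `Γ(N)^∨ = ⨁ₙ Hom_A(Γⁿ(N), A)`. -/
def GradedDual (A : Type*) [CommRing A] (N : Type*) [AddCommGroup N] [Module A N] : Type _ :=
  ⨁ n, Module.Dual A (grade A N n)

namespace GradedDual

instance : AddCommGroup (GradedDual A N) :=
  inferInstanceAs (AddCommGroup (⨁ n, Module.Dual A (grade A N n)))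

instance : Module A (GradedDual A N) :=
  inferInstanceAs (Module A (⨁ n, Module.Dual A (grade A N n)))

/-- The inclusion of the degree `n` part `Hom_A(Γⁿ(N), A)` into `Γ(N)^∨`. -/
def of (n : ℕ) : Module.Dual A (grade A N n) →ₗ[A] GradedDual A N :=
  DirectSum.lof A ℕ (fun n => Module.Dual A (grade A N n)) n

/-- Linear maps out of `Γ(N)^∨` are given by linear maps out of each degree. -/
def lift {P : Type*} [AddCommGroup P] [Module A P]
    (f : ∀ n, Module.Dual A (grade A N n) →ₗ[A] P) : GradedDual A N →ₗ[A] P :=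
  DirectSum.toModule A ℕ P f

lemma lift_of {P : Type*} [AddCommGroup P] [Module A P]
    (f : ∀ n, Module.Dual A (grade A N n) →ₗ[A] P) (n : ℕ) (u : Module.Dual A (grade A N n)) :
    lift f (of n u) = f n u :=
  DirectSum.toModule_lof ..

lemma hom_ext {P : Type*} [AddCommGroup P] [Module A P] {f g : GradedDual A N →ₗ[A] P}
    (h : ∀ n u, f (of n u) = g (of n u)) : f = g :=
  DirectSum.linearMap_ext A fun n => LinearMap.ext (h n)

/-- The product of `u ∈ Γᵐ(N)^*` and `v ∈ Γⁿ(N)^*` is the functional `(u ⊗ v) ∘ Δ` on `Γᵐ⁺ⁿ(N)`,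
where `u ⊗ v` is extended by zero outside of `Γᵐ(N) ⊗ Γⁿ(N)`. -/
def mulDegree (m n : ℕ) : Module.Dual A (grade A N m) →ₗ[A] Module.Dual A (grade A N n) →ₗ[A]
    Module.Dual A (grade A N (m + n)) :=
  LinearMap.mk₂ A
    (fun u v => LinearMap.mul' A A ∘ₗ TensorProduct.map (u ∘ₗ gradeProj m) (v ∘ₗ gradeProj n) ∘ₗ
      Coalgebra.comul ∘ₗ (grade A N (m + n)).subtype)
    (fun u u' v => by simp only [LinearMap.add_comp, TensorProduct.map_add_left, LinearMap.comp_add])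
    (fun c u v => by
      simp only [LinearMap.smul_comp, TensorProduct.map_smul_left, LinearMap.comp_smul])
    (fun u v v' => by
      simp only [LinearMap.add_comp, TensorProduct.map_add_right, LinearMap.comp_add])
    (fun c u v => by
      simp only [LinearMap.smul_comp, TensorProduct.map_smul_right, LinearMap.comp_smul])

/-- The multiplication of `Γ(N)^∨`, as a bilinear map. -/
def mulHom : GradedDual A N →ₗ[A] GradedDual A N →ₗ[A] GradedDual A N :=
  lift fun m => LinearMap.flip <| lift fun n => LinearMap.flip <|
    (mulDegree m n).compr₂ (of (m + n))

instance : Mul (GradedDual A N) := ⟨fun x y => mulHom x y⟩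

lemma mul_def (x y : GradedDual A N) : x * y = mulHom x y := rfl

lemma of_mul_of (m n : ℕ) (u : Module.Dual A (grade A N m)) (v : Module.Dual A (grade A N n)) :
    of m u * of n v = of (m + n) (mulDegree m n u v) := by
  rw [mul_def, mulHom, lift_of, LinearMap.flip_apply, lift_of]
  rfl

/-- The unit of `Γ(N)^∨` is the counit of `Γ(N)`, in degree `0`. -/
instance : One (GradedDual A N) := ⟨of 0 (Coalgebra.counit ∘ₗ (grade A N 0).subtype)⟩

lemma one_def : (1 : GradedDual A N) = of 0 (Coalgebra.counit ∘ₗ (grade A N 0).subtype) := rfl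

/-- Elements of `Γ(N)^∨` as functionals on all of `Γ(N)`. -/
def toFunctional : GradedDual A N →ₗ[A] WithConv (DividedPowerAlgebra A N →ₗ[A] A) :=
  lift fun n => (WithConv.linearEquiv A (DividedPowerAlgebra A N →ₗ[A] A)).symm.toLinearMap ∘ₗ
    (gradeProj n).dualMap

lemma toFunctional_of (n : ℕ) (u : Module.Dual A (grade A N n)) :
    toFunctional (of n u) = WithConv.toConv (u ∘ₗ gradeProj n) := by
  rw [toFunctional, lift_of]; rfl

lemma toFunctional_injective :
    Function.Injective (toFunctional : GradedDual A N →ₗ[A] _) := by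
  have key : ∀ (n : ℕ) (x : GradedDual A N) (z : grade A N n),
      toFunctional x (z : DividedPowerAlgebra A N) =
        DirectSum.component A ℕ (fun n => Module.Dual A (grade A N n)) n x z := by
    intro n x z
    induction x using DirectSum.induction_on with
    | zero => rw [map_zero]; erw [map_zero]; rfl
    | of m u =>
      have h := toFunctional_of m u
      change toFunctional (of m u) (z : DividedPowerAlgebra A N) =
        DirectSum.component A ℕ (fun n => Module.Dual A (grade A N n)) n
          (DirectSum.lof A ℕ (fun n => Module.Dual A (grade A N n)) m u) z
      rw [h]
      change u (gradeProj m z) = _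
      by_cases hmn : m = n
      · subst hmn
        rw [gradeProj_same, DirectSum.component.lof_self]
      · rw [gradeProj_ne (Ne.symm hmn) z.2, DirectSum.component.of, dif_neg hmn]
        simp
    | add x y hx hy =>
      erw [map_add, map_add]
      change toFunctional x (z : DividedPowerAlgebra A N) +
        toFunctional y (z : DividedPowerAlgebra A N) = _
      rw [hx, hy]; rfl
  intro x y h
  refine DirectSum.ext_component A fun n => ?_
  ext z
  rw [← key, ← key, h]

lemma linearMap_ext_grade {P : Type*} [AddCommGroup P] [Module A P]
    {f g : DividedPowerAlgebra A N →ₗ[A] P} (h : ∀ n, ∀ z ∈ grade A N n, f z = g z) : f = g := by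
  ext z
  induction z using DirectSum.Decomposition.inductionOn (grade A N) with
  | zero => rw [map_zero, map_zero]
  | homogeneous z => exact h _ _ z.2
  | add z w hz hw => rw [map_add, map_add, hz, hw]

lemma counit_eq_zero {n : ℕ} (hn : n ≠ 0) {z : DividedPowerAlgebra A N} (hz : z ∈ grade A N n) :
    Coalgebra.counit (R := A) z = 0 := by
  rw [counit_apply]
  induction hz using Submodule.span_induction with
  | mem z h =>
    obtain ⟨l, rfl, rfl⟩ := h
    obtain ⟨k, hk, hk0⟩ : ∃ k ∈ l.map Prod.fst, k ≠ 0 := by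
      by_contra! h
      exact hn (List.sum_eq_zero h)
    obtain ⟨p, hp, rfl⟩ := List.mem_map.1 hk
    rw [map_list_prod]
    refine List.prod_eq_zero ?_
    rw [List.map_map]
    exact List.mem_map.2 ⟨p, hp, by simp [hk0]⟩
  | zero => exact map_zero _
  | add x y _ _ h1 h2 => rw [map_add, h1, h2, add_zero]
  | smul a x _ h => rw [map_smul, h, smul_zero]

lemma toFunctional_one : toFunctional (1 : GradedDual A N) = 1 := by
  rw [one_def, toFunctional_of]
  refine WithConv.ofConv_injective (linearMap_ext_grade fun n z hz => ?_)
  change Coalgebra.counit (gradeProj 0 z : DividedPowerAlgebra A N) =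
    Coalgebra.counit (R := A) z
  by_cases h : n = 0
  · subst h
    rw [gradeProj_same 0 ⟨z, hz⟩]
  · rw [counit_eq_zero h hz, gradeProj_ne h hz]
    exact map_zero _

lemma toFunctional_mul (x y : GradedDual A N) :
    toFunctional (x * y) = toFunctional x * toFunctional y := by
  have h : (mulHom (A := A) (N := N)).compr₂ toFunctional =
      (LinearMap.mul A (WithConv (DividedPowerAlgebra A N →ₗ[A] A))).compl₁₂
        toFunctional toFunctional := by
    refine hom_ext fun m u => hom_ext fun n v => ?_
    change toFunctional (of m u * of n v) = toFunctional (of m u) * toFunctional (of n v)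
    rw [of_mul_of, toFunctional_of, toFunctional_of, toFunctional_of]
    refine WithConv.ofConv_injective (linearMap_ext_grade fun k z hz => ?_)
    change LinearMap.mul' A A (TensorProduct.map (u ∘ₗ gradeProj m) (v ∘ₗ gradeProj n)
        (Coalgebra.comul (gradeProj (m + n) z : DividedPowerAlgebra A N))) =
      LinearMap.mul' A A (TensorProduct.map (u ∘ₗ gradeProj m) (v ∘ₗ gradeProj n)
        (Coalgebra.comul z))
    by_cases hk : k = m + n
    · subst hk
      rw [gradeProj_same _ ⟨z, hz⟩]
    · rw [gradeProj_ne hk hz, ZeroMemClass.coe_zero, map_zero, map_zero, map_zero]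
      have := comul_mem_tensorGrade hz
      generalize Coalgebra.comul (R := A) z = t at this
      induction this using Submodule.span_induction with
      | mem t h =>
        obtain ⟨i, j, hij, a, ha, b, hb, rfl⟩ := h
        rw [TensorProduct.map_tmul, LinearMap.mul'_apply, LinearMap.comp_apply,
          LinearMap.comp_apply]
        by_cases hi : i = m
        · have hj : j ≠ n := by omega
          rw [gradeProj_ne hj hb, map_zero, mul_zero]
        · rw [gradeProj_ne hi ha, map_zero, zero_mul]
      | zero => rw [map_zero, map_zero]
      | add x y _ _ h1 h2 => rw [map_add, map_add, ← h1, ← h2, add_zero]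
      | smul a x _ h => rw [map_smul, map_smul, ← h, smul_zero]
  exact congr($h x y)

instance : CommRing (GradedDual A N) where
  __ := (inferInstance : AddCommGroup (GradedDual A N))
  left_distrib x y z := by simp only [mul_def, map_add]
  right_distrib x y z := by simp only [mul_def, map_add, LinearMap.add_apply]
  zero_mul x := by simp only [mul_def, map_zero, LinearMap.zero_apply]
  mul_zero x := by simp only [mul_def, map_zero]
  mul_assoc x y z := toFunctional_injective (by simp only [toFunctional_mul, mul_assoc])
  one_mul x := toFunctional_injective (by simp only [toFunctional_mul, toFunctional_one, one_mul])
  mul_one x := toFunctional_injective (by simp only [toFunctional_mul, toFunctional_one, mul_one])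
  mul_comm x y := toFunctional_injective (by simp only [toFunctional_mul, mul_comm])

instance : Algebra A (GradedDual A N) :=
  Algebra.ofModule (fun r x y => by simp only [mul_def, map_smul, LinearMap.smul_apply])
    (fun r x y => by simp only [mul_def, map_smul])

end GradedDual

/-- A left inverse `Γ(N) → N` of `x ↦ γ¹(x)`; it kills `Γⁿ(N)` for `n ≠ 1`. -/
def toModule : DividedPowerAlgebra A N →ₗ[A] N :=
  letI : Module Aᵐᵒᵖ N := Module.compHom N ((RingHom.id A).fromOpposite mul_comm)
  haveI : IsCentralScalar A N := ⟨fun _ _ => rfl⟩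
  TrivSqZeroExt.sndHom A N ∘ₗ (lift' (R := A) (M := N) (A := TrivSqZeroExt A N)
    (f := fun p : ℕ × N => if p.1 = 0 then 1 else if p.1 = 1 then TrivSqZeroExt.inr p.2 else 0)
    (fun x => by simp)
    (fun n r x => by
      rcases n with _ | _ | n <;> simp)
    (fun n p x => by
      rcases n with _ | _ | n <;> rcases p with _ | _ | p <;> simp
      intro h
      omega)
    (fun n x y => by
      rcases n with _ | _ | n
      · simp
      · simp [Finset.Nat.antidiagonal_succ, add_comm]
      · rw [Finset.sum_eq_zero]
        · simp
        rintro ⟨a, b⟩ h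
        have := Finset.HasAntidiagonal.mem_antidiagonal.1 h
        rcases a with _ | _ | a <;> rcases b with _ | _ | b <;> simp_all)).toLinearMap

lemma toModule_dp_one (x : N) : toModule (dp A 1 x) = x := by
  simp [toModule]

/-- The degree one part of `Γ(N)` is `N`, via `x ↦ γ¹(x)`. -/
def degreeOneEquiv : N ≃ₗ[A] grade A N 1 :=
  LinearEquiv.ofBijective ((embed A N).codRestrict (grade A N 1) (dp_mem_grade 1)) (by
    constructor
    · intro x y h
      have h' : dp A 1 x = dp A 1 y := congrArg Subtype.val h
      rw [← toModule_dp_one (A := A) x, h', toModule_dp_one]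
    · rintro ⟨z, hz⟩
      suffices h : z ∈ LinearMap.range (embed A N) by
        obtain ⟨x, rfl⟩ := h
        exact ⟨x, rfl⟩
      have h0 : ∀ l : List (ℕ × N), (l.map Prod.fst).sum = 0 →
          (l.map fun p => dp A p.1 p.2).prod = 1 := by
        intro l
        induction l with
        | nil => simp
        | cons p l ih =>
          intro h
          simp only [List.map_cons, List.sum_cons, Nat.add_eq_zero_iff] at h
          rw [List.map_cons, List.prod_cons, ih h.2, h.1, dp_zero, mul_one]
      refine Submodule.span_le.2 ?_ hz
      rintro _ ⟨l, hl, rfl⟩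
      induction l with
      | nil => simp at hl
      | cons p l ih =>
        simp only [List.map_cons, List.sum_cons] at hl
        rw [List.map_cons, List.prod_cons]
        obtain h | h : p.1 = 0 ∨ p.1 = 1 := by omega
        · rw [h, dp_zero, one_mul]
          exact ih (by omega)
        · rw [h0 l (by omega), mul_one, h]
          exact ⟨p.2, rfl⟩)

end DividedPowerAlgebra

section Rees

/-- The algebra map `Sym(g) : Sym(M) → Sym(E)` induced by a linear map `g : M → E`. -/
def SymmetricAlgebra.mapHom {A M E : Type*} [CommRing A] [AddCommGroup M] [Module A M]
    [AddCommGroup E] [Module A E] (g : M →ₗ[A] E) :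
    SymmetricAlgebra A M →ₐ[A] SymmetricAlgebra A E :=
  SymmetricAlgebra.lift (SymmetricAlgebra.ι A E ∘ₗ g)

/-- The degree `n` part `Symⁿ(M)` of the symmetric algebra. -/
def SymmetricAlgebra.grade (A M : Type*) [CommRing A] [AddCommGroup M] [Module A M] (n : ℕ) :
    Submodule A (SymmetricAlgebra A M) :=
  LinearMap.range (SymmetricAlgebra.ι A M) ^ n

namespace Module

/-- The ideal `⋂_g ker Sym(g)` of `Sym(M)`, where `g` runs over all linear maps from `M` to
free modules `E`. The free modules are taken in `Type (max u w)`, where `A : Type u` and where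
`w` is an arbitrary universe. -/
def reesIdeal (A : Type u) (M : Type v) [CommRing A] [AddCommGroup M] [Module A M] :
    Ideal (SymmetricAlgebra A M) :=
  ⨅ (E : Type (max u w)) (_ : AddCommGroup E) (_ : Module A E) (_ : Module.Free A E)
    (g : M →ₗ[A] E), RingHom.ker (SymmetricAlgebra.mapHom g)

/-- The Rees algebra `R(M) = Sym(M) / ⋂_g ker Sym(g)` of Eisenbud, Huneke and Ulrich. -/
abbrev ReesAlgebra (A : Type u) (M : Type v) [CommRing A] [AddCommGroup M] [Module A M] : Type _ :=
  SymmetricAlgebra A M ⧸ reesIdeal.{u, v, w} A M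

/-- The degree `n` part of the Rees algebra: the image of `Symⁿ(M)`. -/
def ReesAlgebra.grade (A : Type u) (M : Type v) [CommRing A] [AddCommGroup M] [Module A M]
    (n : ℕ) : Submodule A (ReesAlgebra.{u, v, w} A M) :=
  (SymmetricAlgebra.grade A M n).map (Ideal.Quotient.mkₐ A (reesIdeal.{u, v, w} A M)).toLinearMap

/-- The canonical algebra map `Sym(M) → Γ(M^*)^∨`. It is induced by the linear map
`M → M^{**} = Γ¹(M^*)^*` into the degree one part of `Γ(M^*)^∨`. -/
def symToGradedDual (A : Type u) (M : Type v) [CommRing A] [AddCommGroup M] [Module A M] :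
    SymmetricAlgebra A M →ₐ[A] DividedPowerAlgebra.GradedDual A (Module.Dual A M) :=
  SymmetricAlgebra.lift <| DividedPowerAlgebra.GradedDual.of 1 ∘ₗ
    (DividedPowerAlgebra.degreeOneEquiv (A := A) (N := Module.Dual A M)).symm.toLinearMap.dualMap ∘ₗ
    Module.Dual.eval A M

end Module

end Rees

end

/-!
The Rees ideal is the kernel of `c_M`, because both are described by the same coefficients. Let
`g : M → E` be a linear map to a free module with basis `(e_k)`, and let `f_k ∈ M^*` be the
coordinates of `g`. Then `Sym(E)` is the polynomial ring in the `e_k`, and for every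
`x ∈ Sym(M)` the coefficient of `∏ e_k^{n_k}` in `Sym(g)(x)` is the value of `c_M(x)` at
`∏ γ^{n_k}(f_k)` (`Module.toMvPowerSeries_symToGradedDual`). Indeed, evaluation at these monomials
is an algebra map from `Γ(M^*)^∨` to the power series ring
(`DividedPowerAlgebra.GradedDual.toMvPowerSeries`), since `Δ` of a monomial is the sum of all
`γ`-monomials tensored with their complements (`DividedPowerAlgebra.comulHom_monomial`); so it is
enough to compare on the generators `M` of `Sym(M)`.

Consequently `c_M(x) = 0` implies `Sym(g)(x) = 0` for all `g`. Conversely any finite family in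
`M^*` is the family of coordinates of a map `M → Aʳ`, and the monomials in finite families span
`Γ(M^*)`, so if all `Sym(g)(x)` vanish, so does `c_M(x)`.

The gradings agree because `c_M` maps `Symⁿ(M)` into degree `n`, and `Γ(M^*)^∨` is the direct sum
of its homogeneous parts.
-/

/-! ### Monomials in the divided power algebra -/

namespace DividedPowerAlgebra

variable {A : Type*} [CommRing A] {N : Type*} [AddCommGroup N] [Module A N] {κ : Type*}

/-- The divided power monomial `∏ₖ γ^{nₖ}(fₖ)` in the elements `fₖ` of `N`. -/
noncomputable def monomial (f : κ → N) (n : κ →₀ ℕ) : DividedPowerAlgebra A N :=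
  n.prod fun k e => dp A e (f k)

lemma monomial_zero (f : κ → N) : monomial (A := A) f 0 = 1 :=
  Finsupp.prod_zero_index

lemma monomial_single (f : κ → N) (k : κ) (e : ℕ) :
    monomial f (Finsupp.single k e) = dp A e (f k) :=
  Finsupp.prod_single_index dp_zero

lemma monomial_single_add (f : κ → N) {k : κ} (e : ℕ) {n : κ →₀ ℕ} (hn : n k = 0) :
    monomial f (Finsupp.single k e + n) = dp A e (f k) * monomial f n := by
  classical
  rw [← monomial_single]
  refine Finsupp.prod_add_index_of_disjoint ?_ _
  refine Finset.disjoint_of_subset_left Finsupp.support_single_subset ?_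
  simpa using hn

lemma monomial_mem_grade (f : κ → N) (n : κ →₀ ℕ) : monomial f n ∈ grade A N n.degree :=
  SetLike.prod_mem_graded (grade A N) n _ fun k _ => dp_mem_grade (n k) (f k)

/-- The monomials in finite families of elements span `Γ(N)`. Repetitions in the family are
allowed, so every product of divided powers is such a monomial. -/
lemma linearMap_eq_zero_of_monomial {P : Type*} [AddCommGroup P] [Module A P]
    {φ : DividedPowerAlgebra A N →ₗ[A] P}
    (h : ∀ (r : ℕ) (f : Fin r → N) (n : Fin r →₀ ℕ), φ (monomial f n) = 0) : φ = 0 := by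
  refine GradedDual.linearMap_ext_grade fun m z hz => ?_
  rw [LinearMap.zero_apply]
  induction hz using Submodule.span_induction with
  | mem z hz =>
    obtain ⟨l, -, rfl⟩ := hz
    convert h l.length (fun i => (l.get i).2) (Finsupp.equivFunOnFinite.symm fun i => (l.get i).1)
    rw [monomial, Finsupp.prod_fintype _ (fun i e => dp A e (l.get i).2) fun i => dp_zero,
      ← List.prod_ofFn]
    congr 1
    refine List.ext_get (by simp) fun i h₁ h₂ => by simp
  | zero => exact map_zero φ
  | add x y _ _ hx hy => rw [map_add, hx, hy, add_zero]
  | smul a x _ hx => rw [map_smul, hx, smul_zero]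

/-- Divided power monomials multiply out under the comultiplication just as the monomials of a
power series ring do under the dual multiplication. -/
lemma comulHom_monomial [DecidableEq κ] (f : κ → N) (n : κ →₀ ℕ) :
    comulHom (monomial (A := A) f n) =
      ∑ p ∈ Finset.HasAntidiagonal.antidiagonal n, monomial f p.1 ⊗ₜ[A] monomial f p.2 := by
  induction n using Finsupp.induction with
  | zero => simp [monomial_zero, Algebra.TensorProduct.one_def]
  | single_add a b m ha _ ih =>
    have hm : m a = 0 := Finsupp.notMem_support_iff.1 ha
    rw [monomial_single_add f b hm, map_mul, ih, comulHom_dp, Finset.sum_mul_sum,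
      ← Finset.sum_product']
    refine Finset.sum_nbij'
      (fun s => (Finsupp.single a s.1.1 + s.2.1, Finsupp.single a s.1.2 + s.2.2))
      (fun p => ((p.1 a, p.2 a), (p.1.erase a, p.2.erase a))) ?_ ?_ ?_ ?_ ?_
    · rintro ⟨⟨i, j⟩, ⟨p, q⟩⟩ h
      simp only [Finset.mem_product, Finset.HasAntidiagonal.mem_antidiagonal] at h ⊢
      obtain ⟨rfl, rfl⟩ := h
      rw [Finsupp.single_add]
      abel
    · rintro ⟨p, q⟩ h
      simp only [Finset.mem_product, Finset.HasAntidiagonal.mem_antidiagonal] at h ⊢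
      refine ⟨by simpa [hm] using DFunLike.congr_fun h a, ?_⟩
      rw [← Finsupp.erase_add, h, Finsupp.erase_add, Finsupp.erase_single, zero_add,
        Finsupp.erase_of_notMem_support ha]
    · rintro ⟨⟨i, j⟩, ⟨p, q⟩⟩ h
      simp only [Finset.mem_product, Finset.HasAntidiagonal.mem_antidiagonal] at h
      have hpq : p a = 0 ∧ q a = 0 := by
        rw [← h.2, Finsupp.add_apply] at hm
        omega
      simp [hpq, Finsupp.erase_add, Finsupp.erase_of_notMem_support]
    · rintro ⟨p, q⟩ -
      simp [Finsupp.single_add_erase]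
    · rintro ⟨⟨i, j⟩, ⟨p, q⟩⟩ h
      simp only [Finset.mem_product, Finset.HasAntidiagonal.mem_antidiagonal] at h
      have hpq : p a = 0 ∧ q a = 0 := by
        rw [← h.2, Finsupp.add_apply] at hm
        omega
      rw [Algebra.TensorProduct.tmul_mul_tmul, monomial_single_add f i hpq.1,
        monomial_single_add f j hpq.2]

lemma counitHom_monomial [DecidableEq κ] (f : κ → N) (n : κ →₀ ℕ) :
    counitHom (monomial (A := A) f n) = if n = 0 then 1 else 0 := by
  split_ifs with h
  · rw [h, monomial_zero, map_one]
  · exact GradedDual.counit_eq_zero (fun h0 => h ((Finsupp.degree_eq_zero_iff n).1 h0))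
      (monomial_mem_grade f n)

/-! ### From the graded dual to power series -/

namespace GradedDual

lemma range_of_mul_le (m n : ℕ) :
    LinearMap.range (of (A := A) (N := N) m) * LinearMap.range (of (A := A) (N := N) n) ≤
      LinearMap.range (of (A := A) (N := N) (m + n)) := by
  rw [Submodule.mul_le]
  rintro _ ⟨x, rfl⟩ _ ⟨y, rfl⟩
  rw [of_mul_of]
  exact ⟨_, rfl⟩

lemma one_mem_range_of : (1 : GradedDual A N) ∈ LinearMap.range (of (A := A) (N := N) 0) :=
  ⟨_, rfl⟩

/-- The algebra map from `Γ(N)^∨` to power series sending a functional `φ` to the series whose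
coefficient at `n` is the value of `φ` at the monomial `∏ₖ γ^{nₖ}(fₖ)`. -/
noncomputable def toMvPowerSeries (f : κ → N) : GradedDual A N →ₐ[A] MvPowerSeries κ A :=
  AlgHom.ofLinearMap
    (LinearMap.pi fun n => LinearMap.applyₗ (monomial f n) ∘ₗ
      (WithConv.linearEquiv A (DividedPowerAlgebra A N →ₗ[A] A)).toLinearMap ∘ₗ toFunctional)
    (by
      classical
      refine MvPowerSeries.ext fun n => ?_
      rw [MvPowerSeries.coeff_one, ← counitHom_monomial f]
      change (toFunctional (1 : GradedDual A N)).ofConv (monomial f n) = _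
      rw [toFunctional_one, LinearMap.convOne_apply, Algebra.algebraMap_self, RingHom.id_apply,
        counit_apply])
    (fun x y => by
      classical
      refine MvPowerSeries.ext fun n => ?_
      rw [MvPowerSeries.coeff_mul]
      change (toFunctional (x * y)).ofConv (monomial f n) = _
      rw [toFunctional_mul, LinearMap.convMul_apply]
      change LinearMap.mul' A A (TensorProduct.map _ _ (comulHom (monomial f n))) = _
      rw [comulHom_monomial, map_sum, map_sum]
      rfl)

lemma coeff_toMvPowerSeries (f : κ → N) (x : GradedDual A N) (n : κ →₀ ℕ) :
    (toMvPowerSeries f x).coeff n = (toFunctional x).ofConv (monomial f n) :=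
  rfl

lemma eq_zero_of_toMvPowerSeries {x : GradedDual A N}
    (h : ∀ (r : ℕ) (f : Fin r → N), toMvPowerSeries f x = 0) : x = 0 := by
  refine toFunctional_injective (WithConv.ofConv_injective ?_)
  rw [map_zero, WithConv.ofConv_zero]
  refine linearMap_eq_zero_of_monomial fun r f n => ?_
  rw [← coeff_toMvPowerSeries, h, map_zero]

end GradedDual

end DividedPowerAlgebra

/-! ### The grading of the symmetric algebra -/

namespace SymmetricAlgebra

variable {A : Type*} [CommRing A] {M : Type*} [AddCommGroup M] [Module A M]

lemma iSup_grade : ⨆ n, grade A M n = ⊤ := by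
  have hmul : (⨆ n, grade A M n) * (⨆ n, grade A M n) ≤ ⨆ n, grade A M n := by
    rw [Submodule.iSup_mul]
    refine iSup_le fun i => ?_
    rw [Submodule.mul_iSup]
    refine iSup_le fun j => ?_
    rw [grade, grade, ← pow_add]
    exact le_iSup (grade A M) (i + j)
  refine eq_top_iff.2 fun x _ => ?_
  induction x using SymmetricAlgebra.induction with
  | algebraMap r =>
    refine Submodule.mem_iSup_of_mem 0 ?_
    rw [grade, pow_zero]
    exact Submodule.algebraMap_mem r
  | ι x =>
    refine Submodule.mem_iSup_of_mem 1 ?_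
    rw [grade, pow_one]
    exact ⟨x, rfl⟩
  | mul a b ha hb => exact hmul (Submodule.mul_mem_mul (ha trivial) (hb trivial))
  | add a b ha hb => exact Submodule.add_mem _ (ha trivial) (hb trivial)

end SymmetricAlgebra

/-! ### The kernel of the canonical map and its compatibility with the gradings -/

namespace Module

open DividedPowerAlgebra

variable {A : Type u} [CommRing A] {M : Type v} [AddCommGroup M] [Module A M]

lemma symToGradedDual_ι (m : M) : symToGradedDual A M (SymmetricAlgebra.ι A M m) =
    GradedDual.of 1 ((degreeOneEquiv (A := A) (N := Dual A M)).symm.toLinearMap.dualMap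
      (Dual.eval A M m)) :=
  SymmetricAlgebra.lift_ι_apply ..

lemma toFunctional_symToGradedDual_ι {κ : Type*} [DecidableEq κ] (f : κ → Dual A M) (m : M)
    (n : κ →₀ ℕ) :
    (GradedDual.toFunctional (symToGradedDual A M (SymmetricAlgebra.ι A M m))).ofConv
      (monomial f n) = n.sum fun k _ => if n = Finsupp.single k 1 then f k m else 0 := by
  rw [symToGradedDual_ι, GradedDual.toFunctional_of]
  change (degreeOneEquiv.symm (gradeProj 1 (monomial f n))) m = _
  by_cases hn : n.degree = 1
  · obtain ⟨k, rfl⟩ : ∃ k, n = Finsupp.single k 1 := by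
      obtain ⟨k, hk⟩ := (Finsupp.range_single_one (σ := κ)).symm.subset hn
      exact ⟨k, hk.symm⟩
    have h : gradeProj 1 (monomial f (Finsupp.single k 1)) = degreeOneEquiv (A := A) (f k) := by
      rw [monomial_single]
      exact gradeProj_same 1 ⟨_, dp_mem_grade 1 (f k)⟩
    rw [h, LinearEquiv.symm_apply_apply, Finsupp.sum, Finsupp.support_single k one_ne_zero]
    simp
  · rw [gradeProj_ne hn (monomial_mem_grade f n), map_zero, LinearMap.zero_apply]
    refine (Finset.sum_eq_zero fun k _ => if_neg ?_).symm
    rintro rfl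
    exact hn (Finsupp.degree_single k 1)

/-- The comparison which drives the argument: if `fₖ` are the coordinates of `g : M → E` with
respect to a basis of `E`, then the coefficients of the polynomial `Sym(g)(x)` are the values of
`c_M(x)` at the divided power monomials in the `fₖ`. -/
lemma toMvPowerSeries_symToGradedDual {E κ : Type*} [AddCommGroup E] [Module A E]
    (b : Basis κ A E) (g : M →ₗ[A] E) (x : SymmetricAlgebra A M) :
    GradedDual.toMvPowerSeries (fun k => b.coord k ∘ₗ g) (symToGradedDual A M x) =
      (SymmetricAlgebra.equivMvPolynomial b (SymmetricAlgebra.mapHom g x) : MvPowerSeries κ A) := by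
  classical
  have h : (GradedDual.toMvPowerSeries fun k => b.coord k ∘ₗ g).comp (symToGradedDual A M) =
      ((MvPolynomial.coeToMvPowerSeries.algHom A).comp
        (SymmetricAlgebra.equivMvPolynomial b).toAlgHom).comp (SymmetricAlgebra.mapHom g) := by
    refine SymmetricAlgebra.algHom_ext (LinearMap.ext fun m => MvPowerSeries.ext fun n => ?_)
    have hg : SymmetricAlgebra.equivMvPolynomial b
        (SymmetricAlgebra.mapHom g (SymmetricAlgebra.ι A M m)) =
          (b.repr (g m)).sum fun k a => a • MvPolynomial.X k := by
      rw [SymmetricAlgebra.mapHom, SymmetricAlgebra.lift_ι_apply]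
      exact (SymmetricAlgebra.lift_ι_apply _ _).trans (Basis.constr_apply ..)
    change (GradedDual.toFunctional (symToGradedDual A M (SymmetricAlgebra.ι A M m))).ofConv
        (monomial (fun k => b.coord k ∘ₗ g) n) =
      ((MvPolynomial.coeToMvPowerSeries.algHom A) (SymmetricAlgebra.equivMvPolynomial b
        (SymmetricAlgebra.mapHom g (SymmetricAlgebra.ι A M m)))).coeff n
    rw [MvPolynomial.coeToMvPowerSeries.algHom_apply, Algebra.algebraMap_self,
      MvPowerSeries.map_id, RingHom.id_apply, MvPolynomial.coeff_coe, hg, toFunctional_symToGradedDual_ι,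
      Finsupp.sum, Finsupp.sum, MvPolynomial.coeff_sum]
    by_cases hn : ∃ k, n = Finsupp.single k 1
    · obtain ⟨k, rfl⟩ := hn
      rw [Finsupp.support_single k one_ne_zero]
      simp [MvPolynomial.coeff_X, Finsupp.single_left_inj]
    · push Not at hn
      rw [Finset.sum_eq_zero fun k _ => if_neg (hn k), Finset.sum_eq_zero fun k _ => ?_]
      simp [MvPolynomial.coeff_X, Ne.symm (hn k)]
  exact congr($h x)

lemma reesIdeal_eq_ker : reesIdeal.{u, v, w} A M = RingHom.ker (symToGradedDual A M) := by
  apply le_antisymm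
  · intro x hx
    refine GradedDual.eq_zero_of_toMvPowerSeries fun r f => ?_
    -- The free module `Aʳ`, placed in the universe over which the Rees ideal quantifies.
    let b : Basis (Fin r) A (ULift.{w} (Fin r → A)) :=
      (Pi.basisFun A (Fin r)).map ULift.moduleEquiv.symm
    let g : M →ₗ[A] ULift.{w} (Fin r → A) := ULift.moduleEquiv.symm.toLinearMap ∘ₗ LinearMap.pi f
    have hf : f = fun k => b.coord k ∘ₗ g := by
      ext k m
      simp [b, g]
    have hgx : SymmetricAlgebra.mapHom g x = 0 := by
      simp only [reesIdeal, Submodule.mem_iInf] at hx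
      exact hx _ _ _ (Module.Free.of_basis b) g
    rw [hf, toMvPowerSeries_symToGradedDual, hgx, map_zero, MvPolynomial.coe_zero]
  · intro x hx
    simp only [reesIdeal, Submodule.mem_iInf]
    intro E _ _ _ g
    let b := Module.Free.chooseBasis A E
    rw [RingHom.mem_ker] at hx ⊢
    refine (SymmetricAlgebra.equivMvPolynomial b).injective
      (MvPolynomial.coe_injective (σ := _) (R := A) ?_)
    rw [← toMvPowerSeries_symToGradedDual, hx, map_zero, map_zero, MvPolynomial.coe_zero]

lemma symToGradedDual_mem_range_of {n : ℕ} {x : SymmetricAlgebra A M}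
    (hx : x ∈ SymmetricAlgebra.grade A M n) :
    symToGradedDual A M x ∈ LinearMap.range (GradedDual.of (A := A) (N := Dual A M) n) := by
  suffices h : (SymmetricAlgebra.grade A M n).map (symToGradedDual A M).toLinearMap ≤
      LinearMap.range (GradedDual.of (A := A) (N := Dual A M) n) from
    h (Submodule.mem_map_of_mem hx)
  induction n generalizing x with
  | zero =>
    rw [SymmetricAlgebra.grade, pow_zero, Submodule.map_one, Submodule.one_le]
    exact GradedDual.one_mem_range_of
  | succ n ih =>
    rw [SymmetricAlgebra.grade, pow_succ, Submodule.map_mul]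
    refine le_trans (mul_le_mul' (ih (Submodule.zero_mem _)) ?_) (GradedDual.range_of_mul_le n 1)
    rintro _ ⟨_, ⟨m, rfl⟩, rfl⟩
    exact ⟨_, (symToGradedDual_ι m).symm⟩

/-- An element of `Sym(M)` whose image is homogeneous of degree `n` has the same image as its
component of degree `n`. -/
lemma exists_mem_grade_symToGradedDual_eq {n : ℕ} {x : SymmetricAlgebra A M}
    (hx : symToGradedDual A M x ∈ LinearMap.range (GradedDual.of (A := A) (N := Dual A M) n)) :
    ∃ y ∈ SymmetricAlgebra.grade A M n, symToGradedDual A M y = symToGradedDual A M x := by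
  obtain ⟨f, hf, rfl⟩ := (Submodule.mem_iSup_iff_exists_finsupp _ x).1
    (SymmetricAlgebra.iSup_grade (A := A) (M := M) ▸ Submodule.mem_top)
  refine ⟨f n, hf n, ?_⟩
  obtain ⟨u, hu⟩ := hx
  -- The projection of the graded dual onto its degree `n` part.
  let π : GradedDual A (Dual A M) →ₗ[A] GradedDual A (Dual A M) :=
    GradedDual.of n ∘ₗ DirectSum.component A ℕ (fun i => Dual A (grade A (Dual A M) i)) n
  have hπ : ∀ i, ∀ y ∈ LinearMap.range (GradedDual.of (A := A) (N := Dual A M) i),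
      π y = if i = n then y else 0 := by
    rintro i _ ⟨y, rfl⟩
    split_ifs with h
    · subst h
      exact congrArg (GradedDual.of i) (DirectSum.component.lof_self ..)
    · refine (congrArg (GradedDual.of n) ?_).trans (map_zero _)
      exact (DirectSum.component.of ..).trans (dif_neg h)
  rw [← hu, ← (hπ n _ ⟨u, rfl⟩).trans (if_pos rfl), hu, Finsupp.sum, map_sum, map_sum]
  simp only [hπ _ _ (symToGradedDual_mem_range_of (hf _))]
  rw [Finset.sum_ite_eq']
  split_ifs with h
  · rfl
  · rw [Finsupp.notMem_support_iff.1 h, map_zero]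

end Module

theorem theoremA {A : Type u} [CommRing A] [IsNoetherianRing A]
    {M : Type v} [AddCommGroup M] [Module A M] [Module.Finite A M] :
    ∃ e : Module.ReesAlgebra.{u, v, w} A M ≃ₐ[A] (Module.symToGradedDual A M).range,
      (∀ x : SymmetricAlgebra A M,
        (e (Ideal.Quotient.mk (Module.reesIdeal.{u, v, w} A M) x) :
          DividedPowerAlgebra.GradedDual A (Module.Dual A M)) = Module.symToGradedDual A M x) ∧
      ∀ (n : ℕ) (z : Module.ReesAlgebra.{u, v, w} A M),
        z ∈ Module.ReesAlgebra.grade.{u, v, w} A M n ↔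
          (e z : DividedPowerAlgebra.GradedDual A (Module.Dual A M)) ∈
            LinearMap.range (DividedPowerAlgebra.GradedDual.of (A := A) (N := Module.Dual A M) n) := by
  let e : Module.ReesAlgebra.{u, v, w} A M ≃ₐ[A] (Module.symToGradedDual A M).range :=
    (Ideal.quotientEquivAlgOfEq A Module.reesIdeal_eq_ker).trans
      (Ideal.quotientKerEquivRange (Module.symToGradedDual A M))
  have he : ∀ x : SymmetricAlgebra A M,
      (e (Ideal.Quotient.mk (Module.reesIdeal.{u, v, w} A M) x) :
        DividedPowerAlgebra.GradedDual A (Module.Dual A M)) = Module.symToGradedDual A M x :=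
    fun x => rfl
  refine ⟨e, he, fun n z => ⟨?_, fun h => ?_⟩⟩
  · rintro ⟨x, hx, rfl⟩
    exact Module.symToGradedDual_mem_range_of hx
  · obtain ⟨x, rfl⟩ := Ideal.Quotient.mk_surjective z
    rw [he] at h
    obtain ⟨y, hy, hyx⟩ := Module.exists_mem_grade_symToGradedDual_eq h
    exact ⟨y, hy, e.injective (Subtype.ext hyx)⟩
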